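/- For a collection $F$ of subsets of a space, the nerve $\mathrm{Nrv}\,F$ is the abstract simplicial complex whose simplices are the nonempty finite subcollections of $F$ with a common point; its homotopy type is that of its geometric realization. Two spaces have the same homotopy type if they are homotopy equivalent. For $x\in\mathbb{R}^2$ and $r>0$ let $B_r(x)=\{y\in\mathbb{R}^2:\|x-y\|\le r\}$, and for $K\subseteq\mathbb{R}^2$ let $\text{Čech}_r(K)=\mathrm{Nrv}\{B_r(x):x\in K\}$. Lemma. (1) Let $K\subseteq\mathbb{R}^2$ be bounded and let $F$ be a finite collection of closed Euclidean balls of positive (not necessarily equal) radii in $\mathbb{R}^2$ with $K\subseteq\bigcup F$. Then $\mathrm{Nrv}\,F$ and $\bigcup F$ have the same homotopy type. (2) In particular, if $K\subseteq\mathbb{R}^2$ is finite and $r>0$, then $\text{Čech}_r(K)$ and the union $\bigcup_{x\in K}B_r(x)$ have the same homotopy type. -/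

import Mathlib

/-- The Euclidean plane. -/
abbrev Plane : Type := EuclideanSpace ℝ (Fin 2)

/-- The nerve `Nrv F` of a collection `F` of subsets of `X`: its simplices are the nonempty finite
subcollections of `F` whose members have a common point. -/
def nerve {X : Type*} (F : Set (Set X)) : PreAbstractSimplicialComplex (Set X) where
  faces := {s | s.Nonempty ∧ (s : Set (Set X)) ⊆ F ∧ (⋂₀ (s : Set (Set X))).Nonempty}
  isRelLowerSet_faces := by
    rintro s ⟨hs, hF, x, hx⟩
    refine ⟨hs, fun t hts ht => ⟨ht, fun B hB => hF (hts hB), x, fun B hB => hx B (hts hB)⟩⟩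

/-- The geometric realization, in barycentric coordinates: the set of families of nonnegative
weights on the vertices that sum to `1` and are supported on a simplex, as a subspace of `ι → ℝ`
(product topology). For a complex with finitely many simplices, this is the usual polyhedron. -/
def geometricRealization {ι : Type*} (L : PreAbstractSimplicialComplex ι) : Set (ι → ℝ) :=
  {w | (∀ i, 0 ≤ w i) ∧ ∃ s ∈ L.faces, (∀ i, i ∉ s → w i = 0) ∧ ∑ i ∈ s, w i = 1}

/-- Two spaces have the same homotopy type if there is a homotopy equivalence between them. -/
def SameHomotopyType (X Y : Type*) [TopologicalSpace X] [TopologicalSpace Y] : Prop :=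
  Nonempty (ContinuousMap.HomotopyEquiv X Y)

/-- `B` is a closed ball of positive radius in the plane. -/
def IsClosedDisk (B : Set Plane) : Prop :=
  ∃ (c : Plane) (r : ℝ), 0 < r ∧ B = Metric.closedBall c r

/-- The collection of the closed balls `B_r(x)`, `x ∈ K`. -/
def cechBalls (r : ℝ) (K : Set Plane) : Set (Set Plane) :=
  {B | ∃ x ∈ K, B = Metric.closedBall x r}

/-- The Čech nerve `Čech_r(K) = Nrv {B_r(x) : x ∈ K}`. -/
def cechNerve (r : ℝ) (K : Set Plane) : PreAbstractSimplicialComplex (Set Plane) :=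
  nerve (cechBalls r K)

/-! The argument needs only that the members of `F` are compact, convex and nonempty. By
compactness, members within a small ε of one point still have a common point, so normalized hat
functions around the members give a map f from the union to the nerve. Conversely, choose a common
point of each simplex and average these points with weights `flagCoordinate`, supported on upper
level sets of w; each such set contains every vertex M of largest weight, so by convexity the
average g(w) lies in M. If x lies in M, then M has largest weight in f(x), so x and g(f(x)) span a
segment in M. The points w and f(g(w)) need not lie in a common simplex, but their normalized
product k(w) has support inside both supports, so straight-line homotopies link f ∘ g to k and k to
the identity. -/

section StraightLine

variable {V : Type*} [AddCommGroup V] [Module ℝ V] [TopologicalSpace V] [IsTopologicalAddGroup V]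
  [ContinuousSMul ℝ V]

/-- Two maps into a subset of a topological vector space that are joined pointwise by segments
inside the subset are homotopic. -/
theorem ContinuousMap.homotopic_of_segment_subset {X : Type*} [TopologicalSpace X] {A : Set V}
    (f g : C(X, A)) (h : ∀ x, segment ℝ (f x : V) (g x) ⊆ A) : f.Homotopic g := by
  refine ⟨⟨⟨fun p => ⟨(1 - (p.1 : ℝ)) • (f p.2 : V) + (p.1 : ℝ) • (g p.2 : V), h p.2
    ⟨1 - p.1, p.1, by linarith [p.1.2.2], p.1.2.1, by ring, rfl⟩⟩, ?_⟩, ?_, ?_⟩⟩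
  · refine Continuous.subtype_mk ?_ _
    fun_prop
  · intro x
    ext
    simp
  · intro x
    ext
    simp

end StraightLine

/-! ### Barycentric coordinates on the nerve and its subdivision. -/

section NerveWeights

variable {X : Type*}

/-- Faces of a simplex are simplices, so the support of w can serve as the witnessing simplex. -/
theorem mem_geometricRealization_nerve {F : Set (Set X)} (hF : F.Finite) {w : Set X → ℝ} :
    w ∈ geometricRealization (nerve F) ↔ (∀ B, 0 ≤ w B) ∧ (∀ B ∉ hF.toFinset, w B = 0) ∧
      ∑ B ∈ hF.toFinset, w B = 1 ∧ ∃ x, ∀ B, w B ≠ 0 → x ∈ B := by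
  classical
  constructor
  · rintro ⟨h0, s, ⟨-, hsF, x, hx⟩, hws, hsum⟩
    have hs : s ⊆ hF.toFinset := fun B hB => hF.mem_toFinset.2 (hsF hB)
    refine ⟨h0, fun B hB => hws B fun h => hB (hs h), ?_, x, fun B hB => hx B ?_⟩
    · rw [← hsum]
      exact (Finset.sum_subset hs fun B _ hB => hws B hB).symm
    · by_contra h
      exact hB (hws B h)
  · rintro ⟨h0, hS, hsum, x, hx⟩
    have hsum' : ∑ B ∈ hF.toFinset with w B ≠ 0, w B = 1 := by
      rw [Finset.sum_filter_ne_zero, hsum]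
    refine ⟨h0, {B ∈ hF.toFinset | w B ≠ 0}, ⟨?_, ?_, x, ?_⟩, ?_, hsum'⟩
    · rw [Finset.nonempty_iff_ne_empty]
      intro h
      simp [h] at hsum'
    · intro B hB
      exact hF.mem_toFinset.1 (Finset.mem_filter.1 hB).1
    · intro B hB
      exact hx B (Finset.mem_filter.1 hB).2
    · intro B hB
      by_contra h
      refine hB (Finset.mem_filter.2 ⟨?_, h⟩)
      by_contra h'
      exact h (hS B h')

/-- Weights on the vertices of a simplex span a segment inside it. -/
theorem segment_subset_geometricRealization_nerve {F : Set (Set X)} (hF : F.Finite)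
    {u v : Set X → ℝ} (hu : u ∈ geometricRealization (nerve F))
    (hv : v ∈ geometricRealization (nerve F)) {x : X} (hxu : ∀ B, u B ≠ 0 → x ∈ B)
    (hxv : ∀ B, v B ≠ 0 → x ∈ B) : segment ℝ u v ⊆ geometricRealization (nerve F) := by
  rintro _ ⟨a, b, ha, hb, hab, rfl⟩
  obtain ⟨hu0, huS, hu1, -⟩ := (mem_geometricRealization_nerve hF).1 hu
  obtain ⟨hv0, hvS, hv1, -⟩ := (mem_geometricRealization_nerve hF).1 hv
  refine (mem_geometricRealization_nerve hF).2
    ⟨fun B => ?_, fun B hB => ?_, ?_, x, fun B hB => ?_⟩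
  · have := hu0 B
    have := hv0 B
    simp only [Pi.add_apply, Pi.smul_apply, smul_eq_mul]
    positivity
  · simp [huS B hB, hvS B hB]
  · simp [Finset.sum_add_distrib, ← Finset.mul_sum, hu1, hv1, hab]
  · by_contra hx
    have h1 : u B = 0 := by
      by_contra h
      exact hx (hxu B h)
    have h2 : v B = 0 := by
      by_contra h
      exact hx (hxv B h)
    simp [h1, h2] at hB

open Classical in
/-- The weights obtained from `u` by restricting to `S` and scaling to total weight `1`. -/
noncomputable def normalizedWeights (S : Finset (Set X)) (u : Set X → ℝ) (B : Set X) : ℝ :=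
  if B ∈ S then u B / ∑ C ∈ S, u C else 0

theorem ne_zero_of_normalizedWeights_ne_zero {S : Finset (Set X)} {u : Set X → ℝ} {B : Set X}
    (h : normalizedWeights S u B ≠ 0) : B ∈ S ∧ u B ≠ 0 := by
  unfold normalizedWeights at h
  split_ifs at h with hB
  · exact ⟨hB, fun h0 => h (by simp [h0])⟩
  · exact absurd rfl h

theorem normalizedWeights_mem {F : Set (Set X)} (hF : F.Finite) {u : Set X → ℝ}
    (h0 : ∀ B, 0 ≤ u B) (hpos : 0 < ∑ B ∈ hF.toFinset, u B) {x : X}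
    (hx : ∀ B ∈ F, u B ≠ 0 → x ∈ B) :
    normalizedWeights hF.toFinset u ∈ geometricRealization (nerve F) := by
  refine (mem_geometricRealization_nerve hF).2
    ⟨fun B => ?_, fun B hB => if_neg hB, ?_, x, fun B hB => ?_⟩
  · unfold normalizedWeights
    split_ifs
    · exact div_nonneg (h0 B) hpos.le
    · exact le_rfl
  · unfold normalizedWeights
    rw [Finset.sum_congr rfl fun B hB => if_pos hB, ← Finset.sum_div, div_self hpos.ne']
  · obtain ⟨h1, h2⟩ := ne_zero_of_normalizedWeights_ne_zero hB
    exact hx B (hF.mem_toFinset.1 h1) h2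

theorem continuous_normalizedWeights {Y : Type*} [TopologicalSpace Y] {S : Finset (Set X)}
    {u : Y → Set X → ℝ} (hu : ∀ B, Continuous fun y => u y B)
    (hpos : ∀ y, ∑ B ∈ S, u y B ≠ 0) : Continuous fun y => normalizedWeights S (u y) := by
  refine continuous_pi fun B => ?_
  unfold normalizedWeights
  split_ifs
  · exact (hu B).div (continuous_finsetSum _ fun C _ => hu C) hpos
  · exact continuous_const

/-- An unnormalized barycentric coordinate of the weights `w` with respect to the barycenter of
`σ`: it is positive exactly when the weights on `σ` are positive and exceed those outside. -/
noncomputable def flagCoordinate [DecidableEq (Set X)] (S : Finset (Set X)) (w : Set X → ℝ)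
    (σ : Finset (Set X)) : ℝ :=
  (∏ B ∈ σ, w B) * ∏ B ∈ σ, ∏ C ∈ S \ σ, max 0 (w B - w C)

theorem continuous_flagCoordinate [DecidableEq (Set X)] (S σ : Finset (Set X)) :
    Continuous fun w : Set X → ℝ => flagCoordinate S w σ := by
  unfold flagCoordinate
  fun_prop

theorem flagCoordinate_nonneg [DecidableEq (Set X)] {S : Finset (Set X)} {w : Set X → ℝ}
    (hw : ∀ B, 0 ≤ w B) (σ : Finset (Set X)) : 0 ≤ flagCoordinate S w σ :=
  mul_nonneg (Finset.prod_nonneg fun B _ => hw B)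
    (Finset.prod_nonneg fun _ _ => Finset.prod_nonneg fun _ _ => le_max_left _ _)

theorem ne_zero_of_flagCoordinate_ne_zero [DecidableEq (Set X)] {S : Finset (Set X)}
    {w : Set X → ℝ} {σ : Finset (Set X)} (h : flagCoordinate S w σ ≠ 0) {B : Set X} (hB : B ∈ σ) :
    w B ≠ 0 :=
  Finset.prod_ne_zero_iff.1 (left_ne_zero_of_mul h) B hB

theorem lt_of_flagCoordinate_ne_zero [DecidableEq (Set X)] {S : Finset (Set X)}
    {w : Set X → ℝ} {σ : Finset (Set X)} (h : flagCoordinate S w σ ≠ 0) {B C : Set X} (hB : B ∈ σ)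
    (hC : C ∈ S) (hCσ : C ∉ σ) : w C < w B := by
  have := Finset.prod_ne_zero_iff.1 (Finset.prod_ne_zero_iff.1 (right_ne_zero_of_mul h) B hB) C
    (Finset.mem_sdiff.2 ⟨hC, hCσ⟩)
  by_contra! hle
  exact this (max_eq_left (by linarith))

theorem exists_flagCoordinate_pos [DecidableEq (Set X)] {S : Finset (Set X)}
    {w : Set X → ℝ} {M : Set X} (hM : M ∈ S) (hmax : ∀ B ∈ S, w B ≤ w M) (hpos : 0 < w M) :
    ∃ σ ∈ S.powerset, σ.Nonempty ∧ 0 < flagCoordinate S w σ := by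
  -- The set of all maximizers of w is an upper level set.
  refine ⟨{B ∈ S | w B = w M}, by simp, ⟨M, by simp [hM]⟩, mul_pos
    (Finset.prod_pos fun B hB => ?_)
    (Finset.prod_pos fun B hB => Finset.prod_pos fun C hC => lt_max_of_lt_right ?_)⟩
  · rw [(Finset.mem_filter.1 hB).2]
    exact hpos
  · obtain ⟨hCS, hC'⟩ := Finset.mem_sdiff.1 hC
    have hne : w C ≠ w M := fun h => hC' (Finset.mem_filter.2 ⟨hCS, h⟩)
    rw [(Finset.mem_filter.1 hB).2, sub_pos]
    exact lt_of_le_of_ne (hmax C hCS) hne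

end NerveWeights

/-! ### The nerve theorem for compact convex sets. -/

section NerveTheorem

/-- Compact sets can be thickened slightly without changing their nerve. -/
theorem exists_pos_thickening_nerve {E : Type*} [MetricSpace E] {F : Set (Set E)} (hF : F.Finite)
    (hcomp : ∀ B ∈ F, IsCompact B) (hne : ∀ B ∈ F, B.Nonempty) :
    ∃ ε : ℝ, 0 < ε ∧ ∀ x ∈ ⋃₀ F, ∃ y, ∀ B ∈ F, Metric.infDist x B < ε → y ∈ B := by
  classical
  have hU : IsCompact (⋃₀ F) := hF.isCompact_sUnion hcomp
  -- Without a common point, the sum of distances to the members of s is continuous and positive,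
  -- hence bounded below on the compact union.
  have key : ∀ s ∈ hF.toFinset.powerset, ∃ δ : ℝ, 0 < δ ∧
      ((⋂₀ (s : Set (Set E))).Nonempty ∨ ∀ x ∈ ⋃₀ F, δ ≤ ∑ B ∈ s, Metric.infDist x B) := by
    intro s hs
    have hsF : ∀ B ∈ s, B ∈ F := fun B hB => hF.mem_toFinset.1 (Finset.mem_powerset.1 hs hB)
    by_cases h : (⋂₀ (s : Set (Set E))).Nonempty
    · exact ⟨1, one_pos, Or.inl h⟩
    · have hcont : ContinuousOn (fun x => ∑ B ∈ s, Metric.infDist x B) (⋃₀ F) :=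
        (continuous_finsetSum _ fun B _ => Metric.continuous_infDist_pt B).continuousOn
      obtain ⟨δ, hδ, hle⟩ := hU.exists_forall_le' hcont (a := 0) fun x _ => by
        refine lt_of_le_of_ne (Finset.sum_nonneg fun B _ => Metric.infDist_nonneg) fun h0 => h ?_
        refine ⟨x, fun B hB => ?_⟩
        rw [(hcomp B (hsF B hB)).isClosed.mem_iff_infDist_zero (hne B (hsF B hB))]
        exact (Finset.sum_eq_zero_iff_of_nonneg fun B _ => Metric.infDist_nonneg).1 h0.symm B hB
      exact ⟨δ, hδ, Or.inr hle⟩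
  have hev : ∀ᶠ ε : ℝ in nhdsWithin 0 (Set.Ioi 0), ∀ s ∈ hF.toFinset.powerset,
      (⋂₀ (s : Set (Set E))).Nonempty ∨ ∀ x ∈ ⋃₀ F, s.card * ε < ∑ B ∈ s, Metric.infDist x B := by
    rw [Filter.eventually_all_finset]
    intro s hs
    obtain ⟨δ, hδ, h | h⟩ := key s hs
    · exact Filter.Eventually.of_forall fun _ => Or.inl h
    · have ht : Filter.Tendsto (fun ε : ℝ => s.card * ε) (nhdsWithin 0 (Set.Ioi 0)) (nhds 0) := by
        have : Continuous fun ε : ℝ => s.card * ε := by fun_prop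
        simpa using (this.tendsto 0).mono_left nhdsWithin_le_nhds
      filter_upwards [ht.eventually_lt_const hδ] with ε hε
      exact Or.inr fun x hx => hε.trans_le (h x hx)
  obtain ⟨ε, hε, hpos⟩ := (hev.and self_mem_nhdsWithin).exists
  refine ⟨ε, hpos, fun x hx => ?_⟩
  -- For the members closer to x than ε, the distances sum to at most card · ε, which excludes the
  -- second alternative.
  rcases hε {B ∈ hF.toFinset | Metric.infDist x B < ε} (by simp) with ⟨y, hy⟩ | h
  · exact ⟨y, fun B hB hlt => hy B (by simp [hB, hlt])⟩
  · refine absurd (h x hx) (not_lt.2 ?_)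
    rw [← nsmul_eq_mul]
    exact Finset.sum_le_card_nsmul _ _ _ fun B hB => (Finset.mem_filter.1 hB).2.le

/-- Weights on the members of a finite collection of compact sets that are maximal at the members
containing a given point, and whose supports have the same nerve as the collection. -/
theorem exists_weights_nerve {E : Type*} [MetricSpace E] {F : Set (Set E)} (hF : F.Finite)
    (hcomp : ∀ B ∈ F, IsCompact B) (hne : ∀ B ∈ F, B.Nonempty) :
    ∃ φ : E → Set E → ℝ, (∀ x B, 0 ≤ φ x B) ∧ (∀ B, Continuous fun x => φ x B) ∧
      (∀ x, ∀ M, x ∈ M → 0 < φ x M ∧ ∀ B, φ x B ≤ φ x M) ∧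
      ∀ x ∈ ⋃₀ F, ∃ y, ∀ B ∈ F, φ x B ≠ 0 → y ∈ B := by
  obtain ⟨ε, hε, hthick⟩ := exists_pos_thickening_nerve hF hcomp hne
  -- Hat functions: the maximum ε is attained on B, and the value is 0 at distance ε or more.
  refine ⟨fun x B => max 0 (ε - Metric.infDist x B), fun x B => le_max_left _ _,
    fun B => continuous_const.max (continuous_const.sub (Metric.continuous_infDist_pt B)),
    fun x M hx => ?_, fun x hx => ?_⟩
  · have hM : max 0 (ε - Metric.infDist x M) = ε := by
      rw [Metric.infDist_zero_of_mem hx, sub_zero, max_eq_right hε.le]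
    simp only [hM]
    exact ⟨hε, fun B => max_le hε.le (sub_le_self _ Metric.infDist_nonneg)⟩
  · obtain ⟨y, hy⟩ := hthick x hx
    refine ⟨y, fun B hB h => hy B hB ?_⟩
    by_contra! hle
    exact h (max_eq_left (by linarith))

theorem exists_max_weight {X : Type*} {F : Set (Set X)} (hF : F.Finite) {w : Set X → ℝ}
    (hw : w ∈ geometricRealization (nerve F)) :
    ∃ M ∈ hF.toFinset, (∀ B ∈ hF.toFinset, w B ≤ w M) ∧ 0 < w M := by
  obtain ⟨h0, -, h1, -⟩ := (mem_geometricRealization_nerve hF).1 hw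
  have hSne : hF.toFinset.Nonempty := by
    rw [Finset.nonempty_iff_ne_empty]
    intro h
    rw [h, Finset.sum_empty] at h1
    exact zero_ne_one h1
  obtain ⟨M, hM, hmax⟩ := hF.toFinset.exists_max_image w hSne
  refine ⟨M, hM, hmax, lt_of_le_of_ne (h0 M) fun h => ?_⟩
  rw [Finset.sum_eq_zero fun B hB => le_antisymm (h ▸ hmax B hB) (h0 B)] at h1
  exact zero_ne_one h1

/-- The nerve of a finite collection of convex sets maps continuously to the ambient space so that
the image of each point lies in the members of largest weight. -/
theorem exists_map_nerve {E : Type*} [NormedAddCommGroup E] [NormedSpace ℝ E]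
    {F : Set (Set E)} (hF : F.Finite) (hconv : ∀ B ∈ F, Convex ℝ B) :
    ∃ G : (Set E → ℝ) → E, (Continuous fun w : geometricRealization (nerve F) => G w) ∧
      ∀ w ∈ geometricRealization (nerve F), ∀ M ∈ hF.toFinset,
        (∀ B ∈ hF.toFinset, w B ≤ w M) → G w ∈ M := by
  classical
  have hp : ∀ σ : Finset (Set E), ∃ p : E, (⋂₀ (σ : Set (Set E))).Nonempty → ∀ B ∈ σ, p ∈ B := by
    intro σ
    by_cases h : (⋂₀ (σ : Set (Set E))).Nonempty
    · exact ⟨h.some, fun _ B hB => h.some_mem B hB⟩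
    -- A junk value: for w in the realization, such σ have coordinate 0.
    · exact ⟨0, fun h' => absurd h' h⟩
  choose p hp using hp
  obtain ⟨T, hT⟩ : ∃ T : Finset (Finset (Set E)),
      ∀ σ, σ ∈ T ↔ σ ∈ hF.toFinset.powerset ∧ σ.Nonempty :=
    ⟨{σ ∈ hF.toFinset.powerset | σ.Nonempty}, fun σ => Finset.mem_filter⟩
  have hsum : ∀ w ∈ geometricRealization (nerve F),
      0 < ∑ σ ∈ T, flagCoordinate hF.toFinset w σ := by
    intro w hw
    obtain ⟨M, hM, hm, hpos⟩ := exists_max_weight hF hw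
    obtain ⟨σ, hσ, hσn, hlt⟩ := exists_flagCoordinate_pos hM hm hpos
    exact Finset.sum_pos' (fun σ _ => flagCoordinate_nonneg hw.1 σ) ⟨σ, (hT σ).2 ⟨hσ, hσn⟩, hlt⟩
  refine ⟨fun w => T.centerMass (flagCoordinate hF.toFinset w) p, ?_, fun w hw M hM hm => ?_⟩
  · have hc : ∀ σ, Continuous
        fun w : geometricRealization (nerve F) => flagCoordinate hF.toFinset w σ :=
      fun σ => (continuous_flagCoordinate _ σ).comp continuous_subtype_val
    unfold Finset.centerMass
    exact ((continuous_finsetSum _ fun σ _ => hc σ).inv₀ fun w => (hsum w w.2).ne').smul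
      (continuous_finsetSum _ fun σ _ => (hc σ).smul continuous_const)
  · obtain ⟨h0, -, -, x, hx⟩ := (mem_geometricRealization_nerve hF).1 hw
    beta_reduce
    -- Only σ with nonzero coordinate matter: they lie in the support of w and contain M, so their
    -- chosen points lie in M.
    rw [← Finset.centerMass_filter_ne_zero]
    refine (hconv M (hF.mem_toFinset.1 hM)).centerMass_mem
      (fun σ _ => flagCoordinate_nonneg h0 σ) ?_ ?_
    · rw [Finset.sum_filter_ne_zero]
      exact hsum w hw
    · intro σ hσ
      obtain ⟨hσT, hσ0⟩ := Finset.mem_filter.1 hσ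
      obtain ⟨hσS, B, hB⟩ := (hT σ).1 hσT
      refine hp σ ⟨x, fun C hC => hx C (ne_zero_of_flagCoordinate_ne_zero hσ0 hC)⟩ M ?_
      by_contra hMσ
      exact (lt_of_flagCoordinate_ne_zero hσ0 hB hM hMσ).not_ge
        (hm B (Finset.mem_powerset.1 hσS hB))

/-- The nerve theorem for finite collections of compact convex sets. -/
theorem sameHomotopyType_nerve_sUnion {E : Type*} [NormedAddCommGroup E] [NormedSpace ℝ E]
    {F : Set (Set E)} (hF : F.Finite) (hcomp : ∀ B ∈ F, IsCompact B)
    (hconv : ∀ B ∈ F, Convex ℝ B) (hne : ∀ B ∈ F, B.Nonempty) :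
    SameHomotopyType (geometricRealization (nerve F)) (⋃₀ F : Set E) := by
  obtain ⟨φ, hφ0, hφc, hφmax, hφ⟩ := exists_weights_nerve hF hcomp hne
  obtain ⟨G, hGc, hGmem⟩ := exists_map_nerve hF hconv
  have hφsum : ∀ x ∈ ⋃₀ F, 0 < ∑ B ∈ hF.toFinset, φ x B := by
    rintro x ⟨B, hB, hx⟩
    exact Finset.sum_pos' (fun B _ => hφ0 x B) ⟨B, hF.mem_toFinset.2 hB, (hφmax x B hx).1⟩
  have hfmem : ∀ x ∈ ⋃₀ F,
      normalizedWeights hF.toFinset (φ x) ∈ geometricRealization (nerve F) := by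
    intro x hx
    obtain ⟨y, hy⟩ := hφ x hx
    exact normalizedWeights_mem hF (hφ0 x) (hφsum x hx) hy
  obtain ⟨f, hf⟩ : ∃ f : C((⋃₀ F : Set E), geometricRealization (nerve F)),
      ∀ x, (f x : Set E → ℝ) = normalizedWeights hF.toFinset (φ x) :=
    ⟨⟨fun x => ⟨normalizedWeights hF.toFinset (φ x), hfmem x x.2⟩, (continuous_normalizedWeights
      (fun B => (hφc B).comp continuous_subtype_val) fun x => (hφsum x x.2).ne').subtype_mk _⟩,
      fun _ => rfl⟩
  have hGU : ∀ w ∈ geometricRealization (nerve F), G w ∈ ⋃₀ F := by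
    intro w hw
    obtain ⟨M, hM, hm, -⟩ := exists_max_weight hF hw
    exact ⟨M, hF.mem_toFinset.1 hM, hGmem w hw M hM hm⟩
  obtain ⟨g, hg⟩ : ∃ g : C(geometricRealization (nerve F), (⋃₀ F : Set E)),
      ∀ w, (g w : E) = G w :=
    ⟨⟨fun w => ⟨G w, hGU w w.2⟩, hGc.subtype_mk _⟩, fun _ => rfl⟩
  -- The common refinement of the weights `w` and `f (g w)`.
  obtain ⟨u, hu⟩ : ∃ u : (Set E → ℝ) → Set E → ℝ, ∀ w B, u w B = w B * φ (G w) B :=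
    ⟨fun w B => w B * φ (G w) B, fun _ _ => rfl⟩
  have hu0 : ∀ w ∈ geometricRealization (nerve F), ∀ B, 0 ≤ u w B := fun w hw B =>
    hu w B ▸ mul_nonneg (hw.1 B) (hφ0 _ B)
  have hune : ∀ {w B}, u w B ≠ 0 → w B ≠ 0 ∧ φ (G w) B ≠ 0 := fun {w B} h =>
    mul_ne_zero_iff.1 (hu w B ▸ h)
  have husum : ∀ w ∈ geometricRealization (nerve F), 0 < ∑ B ∈ hF.toFinset, u w B := by
    intro w hw
    obtain ⟨M, hM, hm, hpos⟩ := exists_max_weight hF hw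
    -- The two supports meet: M has positive weight in w, and g(w) lies in M.
    refine Finset.sum_pos' (fun B _ => hu0 w hw B) ⟨M, hM, ?_⟩
    rw [hu]
    exact mul_pos hpos (hφmax _ M (hGmem w hw M hM hm)).1
  have humem : ∀ w ∈ geometricRealization (nerve F),
      normalizedWeights hF.toFinset (u w) ∈ geometricRealization (nerve F) := by
    intro w hw
    obtain ⟨-, -, -, x, hx⟩ := (mem_geometricRealization_nerve hF).1 hw
    exact normalizedWeights_mem hF (hu0 w hw) (husum w hw) fun B _ h => hx B (hune h).1
  have huc : ∀ B, Continuous fun w : geometricRealization (nerve F) => u w B := by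
    intro B
    simp only [hu]
    exact ((continuous_apply B).comp continuous_subtype_val).mul ((hφc B).comp hGc)
  obtain ⟨k, hk⟩ : ∃ k : C(geometricRealization (nerve F), geometricRealization (nerve F)),
      ∀ w, (k w : Set E → ℝ) = normalizedWeights hF.toFinset (u w) :=
    ⟨⟨fun w => ⟨normalizedWeights hF.toFinset (u w), humem w w.2⟩,
      (continuous_normalizedWeights huc fun w => (husum w w.2).ne').subtype_mk _⟩, fun _ => rfl⟩
  have h1 : (f.comp g).Homotopic k := by
    refine ContinuousMap.homotopic_of_segment_subset _ _ fun w => ?_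
    obtain ⟨y, hy⟩ := hφ (G w) (hGU w w.2)
    refine segment_subset_geometricRealization_nerve hF (f (g w)).2 (k w).2 (x := y)
      (fun B hB => ?_) fun B hB => ?_
    · rw [ContinuousMap.comp_apply, hf, hg] at hB
      obtain ⟨hBS, hB'⟩ := ne_zero_of_normalizedWeights_ne_zero hB
      exact hy B (hF.mem_toFinset.1 hBS) hB'
    · rw [hk] at hB
      obtain ⟨hBS, hB'⟩ := ne_zero_of_normalizedWeights_ne_zero hB
      exact hy B (hF.mem_toFinset.1 hBS) (hune hB').2
  have h2 : k.Homotopic (ContinuousMap.id _) := by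
    refine ContinuousMap.homotopic_of_segment_subset _ _ fun w => ?_
    obtain ⟨-, -, -, x, hx⟩ := (mem_geometricRealization_nerve hF).1 w.2
    refine segment_subset_geometricRealization_nerve hF (k w).2 w.2 (x := x) (fun B hB => ?_) hx
    rw [hk] at hB
    exact hx B (hune (ne_zero_of_normalizedWeights_ne_zero hB).2).1
  have h3 : (g.comp f).Homotopic (ContinuousMap.id _) := by
    refine ContinuousMap.homotopic_of_segment_subset _ _ fun x => ?_
    obtain ⟨M, hMF, hxM⟩ := x.2
    have hMS := hF.mem_toFinset.2 hMF
    have hGM : (g (f x) : E) ∈ M := by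
      rw [hg, hf]
      refine hGmem _ (hfmem x x.2) M hMS fun B hB => ?_
      unfold normalizedWeights
      rw [if_pos hB, if_pos hMS]
      exact div_le_div_of_nonneg_right ((hφmax x M hxM).2 B) (hφsum x x.2).le
    exact ((hconv M hMF).segment_subset hGM hxM).trans (Set.subset_sUnion_of_mem hMF)
  exact ⟨⟨g, f, h1.trans h2, h3⟩⟩

end NerveTheorem

theorem sameHomotopyType_nerve_disks {F : Set (Set Plane)} (hF : F.Finite)
    (hdisk : ∀ B ∈ F, IsClosedDisk B) :
    SameHomotopyType (geometricRealization (nerve F)) (⋃₀ F : Set Plane) := by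
  refine sameHomotopyType_nerve_sUnion hF ?_ ?_ ?_ <;> intro B hB <;>
    obtain ⟨c, r, hr, rfl⟩ := hdisk B hB
  · exact isCompact_closedBall c r
  · exact convex_closedBall c r
  · exact Metric.nonempty_closedBall.2 hr.le

theorem mainTheorem2 :
    (∀ (K : Set Plane) (F : Set (Set Plane)),
      Bornology.IsBounded K → F.Finite → (∀ B ∈ F, IsClosedDisk B) → K ⊆ ⋃₀ F →
        SameHomotopyType (geometricRealization (nerve F)) (⋃₀ F : Set Plane)) ∧
    (∀ (K : Set Plane) (r : ℝ), K.Finite → 0 < r →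
      SameHomotopyType (geometricRealization (cechNerve r K)) (⋃₀ cechBalls r K : Set Plane)) := by
  refine ⟨fun _ F _ hF hdisk _ => sameHomotopyType_nerve_disks hF hdisk, fun K r hK hr => ?_⟩
  refine sameHomotopyType_nerve_disks ((hK.image fun x => Metric.closedBall x r).subset ?_) ?_
  · rintro _ ⟨x, hx, rfl⟩
    exact ⟨x, hx, rfl⟩
  · rintro _ ⟨x, -, rfl⟩
    exact ⟨x, r, hr, rfl⟩
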